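/- Let $q$ be a prime power and $\mathbb{F}_q$ the field with $q$ elements. On $\mathbb{F}_q^{2n}$ consider the symplectic inner product $\langle x,y\rangle_{\rm s}=\sum_{i=1}^n (x_iy_{n+i}-x_{n+i}y_i)$. A linear $[2n,k]_q$ code is a $k$-dimensional subspace $C\subseteq\mathbb{F}_q^{2n}$; its symplectic dual is $C^{\perp_{\rm s}}=\{y:\langle x,y\rangle_{\rm s}=0 \text{ for all } x\in C\}$, its symplectic hull is $C\cap C^{\perp_{\rm s}}$, and $C$ is symplectic LCD if $C\cap C^{\perp_{\rm s}}=\{0\}$. Let $\mathrm{SHull}[2n,k]_q^{\ell}$ be the set of all linear $[2n,k]_q$ codes with $\ell$-dimensional symplectic hull, and $\mathrm{SLCD}[2n,k]_q$ the set of all symplectic LCD $[2n,k]_q$ codes. Write $$\begin{bmatrix} n\\ k\end{bmatrix}_q=\prod_{i=0}^{k-1}\frac{q^n-q^i}{q^k-q^i},\qquad h_{q,\ell}=\prod_{i=1}^{\ell}(q^i-1),\qquad g_{q,\infty}=\lim_{n\to\infty}\prod_{i=1}^{n}\left(1-\frac1{q^i}\right).$$ **Theorem.** For every fixed integer $\ell\ge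 0$, $$\lim_{\substack{k\to\infty\\ 2n-k\to\infty}}\frac{|\mathrm{SHull}[2n,k]_q^{\ell}|}{\begin{bmatrix}2n\\ k\end{bmatrix}_q}=\frac{q^{\ell}\, g_{q,\infty}}{h_{q,\ell}\, g_{q^2,\infty}},$$ where the limit is taken over pairs of nonnegative integers $(n,k)$ with $\ell\le k\le 2n$ and $k-\ell$ even. In particular, for $\ell=0$, $$\lim_{\substack{k\to\infty\\ 2n-k\to\infty}}\frac{|\mathrm{SHull}[2n,k]_q^{0}|}{\begin{bmatrix}2n\\ k\end{bmatrix}_q}=\lim_{\substack{k_0\to\infty\\ n-k_0\to\infty}}\frac{|\mathrm{SLCD}[2n,2k_0]_q|}{\begin{bmatrix}2n\\ 2k_0\end{bmatrix}_q}=\frac{g_{q,\infty}}{g_{q^2,\infty}},$$ where in the first limit $k$ is restricted to even integers with $0\le k\le 2n$. -/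

import Mathlib

open Filter Topology

noncomputable section

namespace SymplecticHull

section Codes

variable {F : Type*} [Field F]

/-- The symplectic inner product
`⟨x, y⟩ₛ = ∑_{i = 1}^{n} (x_i y_{n+i} - x_{n+i} y_i)` on `F ^ (2n)`
(coordinates are indexed from `0`). -/
def sympForm (F : Type*) [Field F] (n : ℕ) : LinearMap.BilinForm F (Fin (2 * n) → F) :=
  LinearMap.mk₂ F
    (fun x y => ∑ i : Fin n,
      (x ⟨i, by omega⟩ * y ⟨n + i, by omega⟩ - x ⟨n + i, by omega⟩ * y ⟨i, by omega⟩))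
    (fun x x' y => by
      simp only [Pi.add_apply, ← Finset.sum_add_distrib]
      exact Finset.sum_congr rfl fun i _ => by ring)
    (fun c x y => by
      simp only [Pi.smul_apply, smul_eq_mul, Finset.mul_sum]
      exact Finset.sum_congr rfl fun i _ => by ring)
    (fun x y y' => by
      simp only [Pi.add_apply, ← Finset.sum_add_distrib]
      exact Finset.sum_congr rfl fun i _ => by ring)
    (fun c x y => by
      simp only [Pi.smul_apply, smul_eq_mul, Finset.mul_sum]
      exact Finset.sum_congr rfl fun i _ => by ring)

/-- The symplectic dual code `{y | ⟨x, y⟩ₛ = 0 for all x ∈ C}`. -/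
def sympDual {n : ℕ} (C : Submodule F (Fin (2 * n) → F)) : Submodule F (Fin (2 * n) → F) :=
  C.orthogonalBilin (sympForm F n)

/-- The symplectic hull of a linear code: its intersection with its symplectic dual. -/
def sympHull {n : ℕ} (C : Submodule F (Fin (2 * n) → F)) : Submodule F (Fin (2 * n) → F) :=
  C ⊓ sympDual C

/-- A code is symplectic LCD if it meets its symplectic dual only in the zero vector. -/
def IsSympLCD {n : ℕ} (C : Submodule F (Fin (2 * n) → F)) : Prop :=
  C ⊓ sympDual C = ⊥

/-- `SHull[2n, k]^ℓ`: the set of all linear `[2n, k]` codes over `F` whose symplectic hull is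
`ℓ`-dimensional. -/
def SHull (F : Type*) [Field F] (n k l : ℕ) : Set (Submodule F (Fin (2 * n) → F)) :=
  {C | Module.finrank F C = k ∧ Module.finrank F (sympHull C) = l}

/-- `SLCD[2n, k]`: the set of all symplectic LCD linear `[2n, k]` codes over `F`. -/
def SLCD (F : Type*) [Field F] (n k : ℕ) : Set (Submodule F (Fin (2 * n) → F)) :=
  {C | Module.finrank F C = k ∧ IsSympLCD C}

end Codes

/-- The Gaussian binomial coefficient
`((q^n - 1)(q^n - q)⋯(q^n - q^(k-1))) / ((q^k - 1)(q^k - q)⋯(q^k - q^(k-1)))`,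
which is `1` for `k = 0`. -/
def gaussBinom (q : ℝ) (n k : ℕ) : ℝ :=
  (∏ i ∈ Finset.range k, (q ^ n - q ^ i)) / ∏ i ∈ Finset.range k, (q ^ k - q ^ i)

/-- `g_{q,n} = ∏_{i=1}^n (1 - 1 / q^i)`. -/
def g (q : ℝ) (n : ℕ) : ℝ := ∏ i ∈ Finset.Icc 1 n, (1 - 1 / q ^ i)

/-- `g_{q,∞}`, the limit of `g_{q,n}` as `n → ∞`; for `q > 1` it exists and is positive, see
`tendsto_g` and `gInf_pos`. -/
def gInf (q : ℝ) : ℝ := limUnder atTop (g q)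

/-- `h_{q,ℓ} = ∏_{i=1}^ℓ (q^i - 1)`. -/
def h (q : ℝ) (l : ℕ) : ℝ := ∏ i ∈ Finset.Icc 1 l, (q ^ i - 1)

/-- The filter of the limit `k → ∞`, `2n - k → ∞` on pairs `(n, k)` of natural numbers that are
subject to `ℓ ≤ k ≤ 2n` and `k = 2 k₀ + ℓ` for a natural number `k₀`. -/
def hullLimit (l : ℕ) : Filter (ℕ × ℕ) :=
  comap (fun p => p.2) atTop ⊓ comap (fun p => 2 * (p.1 : ℤ) - (p.2 : ℤ)) atTop ⊓
    𝓟 {p | l ≤ p.2 ∧ p.2 ≤ 2 * p.1 ∧ ∃ k₀ : ℕ, p.2 = 2 * k₀ + l}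

/-- The filter of the limit `k₀ → ∞`, `n - k₀ → ∞` on pairs `(n, k₀)` of natural numbers. -/
def lcdLimit : Filter (ℕ × ℕ) :=
  comap (fun p => p.2) atTop ⊓ comap (fun p => (p.1 : ℤ) - (p.2 : ℤ)) atTop

lemma g_factor {q : ℝ} (hq : 1 < q) (i : ℕ) (hi : 1 ≤ i) :
    0 < 1 - 1 / q ^ i ∧ 1 - 1 / q ^ i < 1 := by
  have h1 : 1 < q ^ i := one_lt_pow₀ hq (by omega)
  have h2 : 1 / q ^ i < 1 := (div_lt_one (by positivity)).2 h1
  have h3 : 0 < 1 / q ^ i := by positivity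
  constructor <;> linarith

lemma g_tendsto_pos {q : ℝ} (hq : 1 < q) : ∃ a, 0 < a ∧ Tendsto (g q) atTop (𝓝 a) := by
  have hr0 : 0 ≤ q⁻¹ := by positivity
  have hr1 : q⁻¹ < 1 := inv_lt_one_of_one_lt₀ hq
  have hsum : Summable fun i : ℕ => -(1 / q ^ (i + 1)) := by
    have := ((summable_geometric_of_lt_one hr0 hr1).mul_left q⁻¹).neg
    refine this.congr fun i => ?_
    simp [pow_succ, mul_comm]
  have hlog : Summable fun i : ℕ => Real.log (1 + -(1 / q ^ (i + 1))) :=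
    Real.summable_log_one_add_of_summable hsum
  have ht := (Real.continuous_exp.tendsto _).comp hlog.hasSum.tendsto_sum_nat
  refine ⟨_, Real.exp_pos _, ht.congr fun n => ?_⟩
  have : g q n = ∏ i ∈ Finset.range n, (1 + -(1 / q ^ (i + 1))) := by
    induction n with
    | zero => simp [g]
    | succ n ih =>
      rw [Finset.prod_range_succ, ← ih, g, g, Finset.prod_Icc_succ_top (by omega), sub_eq_add_neg]
  rw [this, Function.comp, Real.exp_sum]
  refine Finset.prod_congr rfl fun i _ => Real.exp_log ?_
  have := (g_factor hq (i + 1) (by omega)).1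
  linarith

lemma tendsto_g {q : ℝ} (hq : 1 < q) : Tendsto (g q) atTop (𝓝 (gInf q)) := by
  obtain ⟨a, _, ha⟩ := g_tendsto_pos hq
  exact tendsto_nhds_limUnder ⟨a, ha⟩

lemma gInf_pos {q : ℝ} (hq : 1 < q) : 0 < gInf q := by
  obtain ⟨a, h0, ha⟩ := g_tendsto_pos hq
  rwa [tendsto_nhds_unique (tendsto_g hq) ha]

end SymplecticHull

end

namespace SymplecticHull

open Module Submodule

/-! The count is exact before any limit is taken. Write `n = k₀ + s + l` and `k = 2 * k₀ + l`. Pairs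
consisting of a code `C` and a hyperbolic pair `(e, f)` in `C` are counted twice. The number of such
pairs in `C` depends only on the dimensions of `C` and its hull (`ncard_hyperbolicPairs`). Splitting
off the plane of `e` and `f` leaves the hull unchanged and lowers both `C` and the ambient space by
two dimensions (`ncard_hullSet_pair`). This gives a recursion in `k₀` that ends at totally isotropic
subspaces, which are counted through their ordered bases (`ncard_hullSet_self`).

The resulting closed form `ncard_hullSet` and the Gaussian binomial carry the same power of `q` up
to a factor `q ^ l`. Their quotient is therefore `q ^ l / h q l` times values of `g` at `q` and `q ^
2` whose indices all tend to infinity.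

Cardinalities are cast to reals so that differences such as `q ^ k - q ^ l` are not truncated. -/

theorem _root_.Set.ncard_mul_eq_ncard_mul {α β : Type*} [Finite α] [Finite β] (r : α → β → Prop)
    {s : Set α} {t : Set β} {m n : ℝ} (hm : ∀ a ∈ s, ({b | b ∈ t ∧ r a b}.ncard : ℝ) = m)
    (hn : ∀ b ∈ t, ({a | a ∈ s ∧ r a b}.ncard : ℝ) = n) :
    (s.ncard : ℝ) * m = t.ncard * n := by
  classical
  have := Fintype.ofFinite α
  have := Fintype.ofFinite β
  have key := Finset.sum_card_bipartiteAbove_eq_sum_card_bipartiteBelow (s := s.toFinset)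
    (t := t.toFinset) r
  have key' : (∑ a ∈ s.toFinset, ((t.toFinset.bipartiteAbove r a).card : ℝ)) =
      ∑ b ∈ t.toFinset, ((s.toFinset.bipartiteBelow r b).card : ℝ) := by exact_mod_cast key
  have h1 : ∀ a ∈ s.toFinset, ((t.toFinset.bipartiteAbove r a).card : ℝ) = m := fun a ha => by
    rw [← hm a (by simpa using ha), Set.ncard_eq_toFinset_card']
    congr 2
    ext b
    simp [Finset.bipartiteAbove]
  have h2 : ∀ b ∈ t.toFinset, ((s.toFinset.bipartiteBelow r b).card : ℝ) = n := fun b hb => by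
    rw [← hn b (by simpa using hb), Set.ncard_eq_toFinset_card']
    congr 2
    ext a
    simp [Finset.bipartiteBelow]
  rw [Finset.sum_congr rfl h1, Finset.sum_congr rfl h2] at key'
  simpa [Set.ncard_eq_toFinset_card'] using key'

/-! ### Splitting off a hyperbolic plane -/

section Alternating

variable {F V : Type*} [Field F] [AddCommGroup V] [Module F V]

/-- The hull of a subspace with respect to a bilinear form. -/
def hull (B : LinearMap.BilinForm F V) (C : Submodule F V) : Submodule F V :=
  C ⊓ C.orthogonalBilin B

/-- The subspaces of `W` of dimension `k` whose hull has dimension `l`. -/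
def hullSet (B : LinearMap.BilinForm F V) (W : Submodule F V) (k l : ℕ) : Set (Submodule F V) :=
  {C | C ≤ W ∧ finrank F C = k ∧ finrank F (hull B C) = l}

/-- The pairs `(e, f)` of vectors of `C` with `B e f = 1`. -/
def hyperbolicPairs (B : LinearMap.BilinForm F V) (C : Submodule F V) : Set (V × V) :=
  {p | p.1 ∈ C ∧ p.2 ∈ C ∧ B p.1 p.2 = 1}

/-- The part of `C` that is orthogonal to both `e` and `f`. -/
def pairPerp (B : LinearMap.BilinForm F V) (e f : V) (C : Submodule F V) : Submodule F V :=
  C ⊓ (LinearMap.ker (B e) ⊓ LinearMap.ker (B f))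

variable {B : LinearMap.BilinForm F V}

theorem mem_hull {C : Submodule F V} {x : V} : x ∈ hull B C ↔ x ∈ C ∧ ∀ y ∈ C, B y x = 0 :=
  Iff.rfl

theorem mem_pairPerp {e f x : V} {C : Submodule F V} :
    x ∈ pairPerp B e f C ↔ x ∈ C ∧ B e x = 0 ∧ B f x = 0 := Iff.rfl

variable (hB : B.IsAlt) {e f : V} (hef : B e f = 1)

include hB hef

theorem form_swap_eq_neg_one : B f e = -1 := by
  rw [← hef, hB.neg_eq]

/-- This is the orthogonal projection along the hyperbolic plane; the signs come from `B f e = -1`.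
-/
theorem sub_mem_pairPerp {C : Submodule F V} (he : e ∈ C) (hf : f ∈ C) {x : V} (hx : x ∈ C) :
    x - B e x • f + B f x • e ∈ pairPerp B e f C := by
  have h1 := form_swap_eq_neg_one hB hef
  refine mem_pairPerp.2 ⟨C.add_mem (C.sub_mem hx (C.smul_mem _ hf)) (C.smul_mem _ he), ?_, ?_⟩
  · simp [hef, hB e]
  · simp [h1, hB f]

/-- `C` is the orthogonal sum of this part and a nondegenerate plane, and the plane contributes
nothing to the radical. -/
theorem hull_pairPerp {C : Submodule F V} (he : e ∈ C) (hf : f ∈ C) :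
    hull B (pairPerp B e f C) = hull B C := by
  ext x
  simp only [mem_hull, mem_pairPerp]
  constructor
  · rintro ⟨⟨hx, hex, hfx⟩, h⟩
    refine ⟨hx, fun y hy => ?_⟩
    have := h _ (sub_mem_pairPerp hB hef he hf hy)
    simpa [hex, hfx] using this
  · rintro ⟨hx, h⟩
    exact ⟨⟨hx, h e he, h f hf⟩, fun y hy => h y hy.1⟩

theorem pairPerp_sup_span {C : Submodule F V} (he : e ∈ C) (hf : f ∈ C) :
    pairPerp B e f C ⊔ span F {e, f} = C := by
  apply le_antisymm
  · refine sup_le inf_le_left (span_le.2 ?_)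
    rintro x (rfl | rfl) <;> assumption
  · intro x hx
    refine mem_sup.2 ⟨_, sub_mem_pairPerp hB hef he hf hx, B e x • f - B f x • e, ?_, by abel⟩
    have h1 : e ∈ span F {e, f} := subset_span (by simp)
    have h2 : f ∈ span F {e, f} := subset_span (by simp)
    exact sub_mem (smul_mem _ _ h2) (smul_mem _ _ h1)

theorem pairPerp_of_sup_span {D : Submodule F V}
    (hD : ∀ x ∈ D, B e x = 0 ∧ B f x = 0) : pairPerp B e f (D ⊔ span F {e, f}) = D := by
  have h1 := form_swap_eq_neg_one hB hef
  ext x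
  rw [mem_pairPerp]
  constructor
  · rintro ⟨hx, hex, hfx⟩
    obtain ⟨d, hd, z, hz, rfl⟩ := mem_sup.1 hx
    obtain ⟨a, b, rfl⟩ := mem_span_pair.1 hz
    have hb : b = 0 := by simpa [hD d hd, hef, hB e] using hex
    have ha : a = 0 := by simpa [hD d hd, h1, hB f] using hfx
    simpa [ha, hb] using hd
  · exact fun hx => ⟨mem_sup_left hx, hD x hx⟩

theorem finrank_pairPerp_add_two [FiniteDimensional F V] {C : Submodule F V}
    (he : e ∈ C) (hf : f ∈ C) : finrank F (pairPerp B e f C) + 2 = finrank F C := by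
  have h1 := form_swap_eq_neg_one hB hef
  have key := finrank_sup_add_finrank_inf_eq (pairPerp B e f C) (span F {e, f})
  have hli : LinearIndependent F ![e, f] := by
    rw [LinearIndependent.pair_iff]
    intro a b hab
    have ha := congrArg (B f) hab
    have hb := congrArg (B e) hab
    simp [h1, hB f] at ha
    simp [hef, hB e] at hb
    exact ⟨ha, hb⟩
  have h2 : finrank F (span F {e, f}) = 2 := by
    have hr : Set.range ![e, f] = {e, f} := by
      rw [Matrix.range_cons, Matrix.range_cons, Matrix.range_empty, Set.union_empty]
      rfl
    rw [← hr, finrank_span_eq_card hli, Fintype.card_fin]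
  have hinf : pairPerp B e f C ⊓ span F {e, f} = ⊥ := by
    rw [eq_bot_iff]
    rintro x ⟨hx, hz⟩
    obtain ⟨a, b, rfl⟩ := mem_span_pair.1 hz
    obtain ⟨-, hex, hfx⟩ := mem_pairPerp.1 hx
    have hb : b = 0 := by simpa [hef, hB e] using hex
    have ha : a = 0 := by simpa [h1, hB f] using hfx
    simp [ha, hb]
  rw [pairPerp_sup_span hB hef he hf, hinf, h2, finrank_bot] at key
  omega

/-- Removing the hyperbolic plane spanned by `e` and `f` is a bijection on subspaces containing
it. -/
theorem ncard_hullSet_pair [FiniteDimensional F V] {W : Submodule F V} (he : e ∈ W) (hf : f ∈ W)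
    (k l : ℕ) : {C | C ∈ hullSet B W (k + 2) l ∧ e ∈ C ∧ f ∈ C}.ncard =
      (hullSet B (pairPerp B e f W) k l).ncard := by
  refine Set.ncard_congr (fun C _ => pairPerp B e f C) ?_ ?_ ?_
  · rintro C ⟨⟨hCW, hk, hl⟩, heC, hfC⟩
    have := finrank_pairPerp_add_two hB hef heC hfC
    exact ⟨inf_le_inf_right _ hCW, by omega, by rwa [hull_pairPerp hB hef heC hfC]⟩
  · rintro C C' ⟨-, h1, h2⟩ ⟨-, h3, h4⟩ h
    rw [← pairPerp_sup_span hB hef h1 h2, ← pairPerp_sup_span hB hef h3 h4]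
    exact congrArg (· ⊔ span F {e, f}) h
  · rintro D ⟨hDW, hk, hl⟩
    have hD := pairPerp_of_sup_span hB hef (D := D) fun x hx => (hDW hx).2
    have heC : e ∈ D ⊔ span F {e, f} := mem_sup_right (subset_span (by simp))
    have hfC : f ∈ D ⊔ span F {e, f} := mem_sup_right (subset_span (by simp))
    refine ⟨D ⊔ span F {e, f}, ⟨⟨sup_le (hDW.trans inf_le_left) (span_le.2 ?_), ?_, ?_⟩,
      heC, hfC⟩, hD⟩
    · rintro x (rfl | rfl) <;> assumption
    · rw [← finrank_pairPerp_add_two hB hef heC hfC, hD, hk]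
    · rw [← hull_pairPerp hB hef heC hfC, hD, hl]

end Alternating

/-! ### Counting hyperbolic pairs and the recursion -/

section Counting

variable {F V : Type*} [Field F] [Fintype F] [AddCommGroup V] [Module F V] [Finite V]
  {B : LinearMap.BilinForm F V}

theorem ncard_submodule (C : Submodule F V) :
    (C : Set V).ncard = Fintype.card F ^ finrank F C := by
  rw [← Nat.card_coe_set_eq, ← Nat.card_eq_fintype_card]
  exact Module.natCard_eq_pow_finrank

/-- A functional that is nonzero on `C` has a kernel of codimension one there, and its level set at
`1` is a coset of that kernel. -/
theorem ncard_affine {C : Submodule F V} (φ : V →ₗ[F] F) {x : V} (hx : x ∈ C) (hφ : φ x ≠ 0) :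
    {y | y ∈ C ∧ φ y = 1}.ncard = Fintype.card F ^ (finrank F C - 1) := by
  have hker : finrank F (C ⊓ LinearMap.ker φ : Submodule F V) = finrank F C - 1 := by
    have h1 := (φ.domRestrict C).finrank_range_add_finrank_ker
    have h2 : LinearMap.range (φ.domRestrict C) = ⊤ :=
      LinearMap.range_eq_top.2 (LinearMap.surjective fun h => hφ (by
        simpa using LinearMap.congr_fun h ⟨x, hx⟩))
    rw [h2, finrank_top, finrank_self, LinearMap.ker_domRestrict] at h1
    have h3 : finrank F (C ⊓ LinearMap.ker φ : Submodule F V) =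
        finrank F ((LinearMap.ker φ).comap C.subtype) := by
      rw [← Submodule.map_comap_subtype, finrank_map_subtype_eq]
    rw [h3]
    change 1 + finrank F ((LinearMap.ker φ).comap C.subtype) = _ at h1
    omega
  rw [← hker, ← ncard_submodule]
  have hz : φ ((φ x)⁻¹ • x) = 1 := by simp [hφ]
  have hzC : (φ x)⁻¹ • x ∈ C := C.smul_mem _ hx
  generalize (φ x)⁻¹ • x = z at hz hzC
  refine Set.ncard_congr (fun y _ => y - z) ?_ ?_ ?_
  · rintro y ⟨hy, h⟩
    exact ⟨C.sub_mem hy hzC, by simp [h, hz]⟩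
  · intro a b _ _ h
    simpa using h
  · rintro y ⟨hy, h⟩
    exact ⟨y + z, ⟨C.add_mem hy hzC, by simpa [hz] using h⟩, by simp⟩

/-- A vector `e` of `C` is the first member of a pair exactly when it lies outside the hull. Then `B
e` is nonzero on `C`, so `f` ranges over an affine hyperplane of `C`. For `k = 0` the truncated
exponent is harmless, since the first factor vanishes. -/
theorem ncard_hyperbolicPairs (hB : B.IsAlt) {C : Submodule F V} {k l : ℕ} (hk : finrank F C = k)
    (hl : finrank F (hull B C) = l) : ((hyperbolicPairs B C).ncard : ℝ) =
      ((Fintype.card F : ℝ) ^ k - (Fintype.card F : ℝ) ^ l) * (Fintype.card F : ℝ) ^ (k - 1) := by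
  have hs : (((C : Set V) \ (hull B C : Set V)).ncard : ℝ) =
      (Fintype.card F : ℝ) ^ k - (Fintype.card F : ℝ) ^ l := by
    rw [Set.cast_ncard_sdiff (fun x hx => hx.1) (Set.toFinite _), ncard_submodule,
      ncard_submodule, hk, hl]
    push_cast
    rfl
  rw [← hs]
  have key := Set.ncard_mul_eq_ncard_mul (fun (e : V) (p : V × V) => p.1 = e)
    (s := (C : Set V) \ (hull B C : Set V)) (t := hyperbolicPairs B C)
    (m := (Fintype.card F : ℝ) ^ (k - 1)) (n := 1) ?_ ?_
  · rw [key, mul_one]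
  · rintro e ⟨heC, he⟩
    obtain ⟨x, hx, hex⟩ : ∃ x ∈ C, B e x ≠ 0 := by
      by_contra! h
      refine he ⟨heC, fun y hy => ?_⟩
      rw [← hB.neg_eq, h y hy, neg_zero]
    have := ncard_affine (B e) hx hex
    rw [hk] at this
    rw [← Nat.cast_pow, ← this]
    congr 1
    refine Set.ncard_congr (fun p _ => p.2) ?_ ?_ ?_
    · rintro ⟨a, b⟩ ⟨⟨-, h1, h2⟩, rfl⟩
      exact ⟨h1, h2⟩
    · rintro p p' ⟨-, h1⟩ ⟨-, h2⟩ h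
      exact Prod.ext (h1.trans h2.symm) h
    · rintro b ⟨h1, h2⟩
      exact ⟨(e, b), ⟨⟨heC, h1, h2⟩, rfl⟩, rfl⟩
  · rintro ⟨e, f⟩ ⟨h1, h2, h3⟩
    have : {a | a ∈ (C : Set V) \ (hull B C : Set V) ∧ (e, f).1 = a} = {e} := by
      ext a
      constructor
      · rintro ⟨-, rfl⟩; rfl
      · rintro rfl
        refine ⟨⟨h1, fun h => ?_⟩, rfl⟩
        have := h.2 f h2
        rw [← hB.neg_eq, h3] at this
        simp at this
    rw [this]
    simp

/-- The number of subspaces with a given hull dimension in a nondegenerate space, by induction on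
the number of hyperbolic planes: if it is `N` for all nondegenerate spaces of dimension `d`, then
it satisfies the stated equation in dimension `d + 2`. -/
theorem ncard_hullSet_add_two (hB : B.IsAlt) {d k l : ℕ} {N : ℝ}
    (ih : ∀ W : Submodule F V, hull B W = ⊥ → finrank F W = d → ((hullSet B W k l).ncard : ℝ) = N)
    {W : Submodule F V} (hW : hull B W = ⊥) (hd : finrank F W = d + 2) :
    ((hullSet B W (k + 2) l).ncard : ℝ) *
      (((Fintype.card F : ℝ) ^ (k + 2) - (Fintype.card F : ℝ) ^ l) *
        (Fintype.card F : ℝ) ^ (k + 1)) =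
      (((Fintype.card F : ℝ) ^ (d + 2) - 1) * (Fintype.card F : ℝ) ^ (d + 1)) * N := by
  -- The ambient space has zero hull, so its own pairs are counted with hull dimension `0`.
  have hp := ncard_hyperbolicPairs hB hd (l := 0) (by rw [hW, finrank_bot])
  rw [pow_zero] at hp
  change _ = (_ - 1) * (Fintype.card F : ℝ) ^ (d + 1) at hp
  rw [← hp]
  refine Set.ncard_mul_eq_ncard_mul (fun C p => p.1 ∈ C ∧ p.2 ∈ C) ?_ ?_
  · rintro C ⟨hCW, hk, hl⟩
    have := ncard_hyperbolicPairs hB hk hl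
    change _ = _ * (Fintype.card F : ℝ) ^ (k + 1) at this
    rw [← this]
    congr 2
    ext p
    exact ⟨fun h => ⟨h.2.1, h.2.2, h.1.2.2⟩, fun h => ⟨⟨hCW h.1, hCW h.2.1, h.2.2⟩, h.1, h.2.1⟩⟩
  · rintro ⟨e, f⟩ ⟨he, hf, hef⟩
    rw [ncard_hullSet_pair hB hef he hf]
    have := finrank_pairPerp_add_two hB hef he hf
    exact ih _ (by rw [hull_pairPerp hB hef he hf, hW]) (by omega)

end Counting

end SymplecticHull

namespace SymplecticHull

/-! ### Product identities for `g` and `h` -/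

section Products

variable {Q : ℝ}

theorem g_zero (Q : ℝ) : g Q 0 = 1 := by simp [g]

theorem h_zero (Q : ℝ) : h Q 0 = 1 := by simp [h]

theorem g_succ (Q : ℝ) (n : ℕ) : g Q (n + 1) = g Q n * (1 - 1 / Q ^ (n + 1)) := by
  rw [g, g, Finset.prod_Icc_succ_top (by omega)]

theorem g_pos (hQ : 1 < Q) (n : ℕ) : 0 < g Q n :=
  Finset.prod_pos fun i hi => (g_factor hQ i (Finset.mem_Icc.1 hi).1).1

theorem h_pos (hQ : 1 < Q) (l : ℕ) : 0 < h Q l :=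
  Finset.prod_pos fun i hi => sub_pos.2 (one_lt_pow₀ hQ (by have := (Finset.mem_Icc.1 hi).1; omega))

/-- Extracting `Q ^ (a + b)` from each factor leaves the factors of `g Q (a + b)` with index above
`a`. Dropping the last factor turns `(a, b + 1)` into `(a + 1, b)`, hence the induction with `a`
free. -/
theorem prod_pow_sub_mul_g (hQ : 1 < Q) (a b : ℕ) :
    (∏ i ∈ Finset.range b, (Q ^ (a + b) - Q ^ i)) * g Q a = Q ^ ((a + b) * b) * g Q (a + b) := by
  have h0 : Q ≠ 0 := by positivity
  induction b generalizing a with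
  | zero => simp
  | succ b ih =>
    have := ih (a + 1)
    rw [show a + (b + 1) = a + 1 + b by ring, Finset.prod_range_succ]
    rw [g_succ] at this
    have e : Q ^ (a + 1 + b) - Q ^ b = Q ^ (a + 1 + b) * (1 - 1 / Q ^ (a + 1)) := by
      rw [pow_add Q (a + 1) b]; field_simp
    rw [e, mul_add (a + 1 + b), pow_add Q _ (_ * 1), mul_one]
    linear_combination Q ^ (a + 1 + b) * this

theorem gaussBinom_add (hQ : 1 < Q) (a b : ℕ) :
    gaussBinom Q (a + b) b = Q ^ (a * b) * g Q (a + b) / (g Q a * g Q b) := by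
  have h0 : Q ≠ 0 := by positivity
  have h1 := prod_pow_sub_mul_g hQ a b
  have h2 := prod_pow_sub_mul_g hQ 0 b
  rw [g_zero, mul_one, zero_add] at h2
  have ha := (g_pos hQ a).ne'
  have hb := (g_pos hQ b).ne'
  rw [gaussBinom, h2, div_eq_div_iff (by positivity) (by positivity), ← mul_assoc, h1]
  ring

theorem prod_pow_sub_eq_mul_h (Q : ℝ) (l : ℕ) :
    ∏ i ∈ Finset.range l, (Q ^ l - Q ^ i) = (∏ i ∈ Finset.range l, Q ^ i) * h Q l := by
  have : h Q l = ∏ i ∈ Finset.range l, (Q ^ (l - i) - 1) := by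
    have h1 : h Q l = ∏ i ∈ Finset.range l, (Q ^ (i + 1) - 1) := by
      rw [h, Finset.range_eq_Ico, Finset.prod_Ico_add' (fun i => Q ^ i - 1)]
      rfl
    rw [h1, ← Finset.prod_range_reflect]
    refine Finset.prod_congr rfl fun i hi => ?_
    rw [show l - 1 - i + 1 = l - i by have := Finset.mem_range.1 hi; omega]
  rw [this, ← Finset.prod_mul_distrib]
  refine Finset.prod_congr rfl fun i hi => ?_
  rw [mul_sub, ← pow_add, mul_one, Nat.add_sub_cancel' (Finset.mem_range.1 hi).le]

/-- The `i`-th factor is a power of `Q` times `1 - 1 / (Q ^ 2) ^ (s + l - i)`, which is where base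
`Q ^ 2` enters. The product of the `Q ^ i` is kept apart because it cancels against the one in
`prod_pow_sub_eq_mul_h`. -/
theorem prod_isotropic (hQ : 1 < Q) (s l : ℕ) :
    (∏ i ∈ Finset.range l, (Q ^ (2 * (s + l) - i) - Q ^ i)) * g (Q ^ 2) s =
      Q ^ (l * (2 * s + l) + l) * (∏ i ∈ Finset.range l, Q ^ i) * g (Q ^ 2) (s + l) := by
  have h0 : Q ≠ 0 := by positivity
  induction l generalizing s with
  | zero => simp
  | succ l ih =>
    have := ih (s + 1)
    rw [g_succ] at this
    have e : ∀ t, Q ^ (t + 2 * (s + 1)) - Q ^ t =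
        Q ^ (t + 2 * (s + 1)) * (1 - 1 / (Q ^ 2) ^ (s + 1)) := fun t => by
      rw [pow_add, ← pow_mul]; field_simp
    rw [show s + (l + 1) = s + 1 + l by ring, Finset.prod_range_succ, Finset.prod_range_succ,
      show 2 * (s + 1 + l) - l = l + 2 * (s + 1) by omega, e]
    rw [show (l + 1) * (2 * s + (l + 1)) + (l + 1) = (l * (2 * (s + 1) + l) + l) + (2 * (s + 1)) by ring,
      pow_add Q l, pow_add Q _ (2 * (s + 1))]
    linear_combination Q ^ l * Q ^ (2 * (s + 1)) * this

end Products

end SymplecticHull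

namespace SymplecticHull

open Module Submodule

/-! ### Isotropic tuples and orthogonal complements -/

section Isotropic

variable {F V : Type*} [Field F] [AddCommGroup V] [Module F V] {B : LinearMap.BilinForm F V}

/-- The linearly independent `l`-tuples of pairwise orthogonal isotropic vectors of `W`. -/
def isotropicTuples (B : LinearMap.BilinForm F V) (W : Submodule F V) (l : ℕ) :
    Set (Fin l → V) :=
  {v | LinearIndependent F v ∧ (∀ i, v i ∈ W) ∧ ∀ i j, B (v i) (v j) = 0}

theorem mem_orthogonalBilin_span_range {ι : Type*} {v : ι → V} {x : V} :
    x ∈ (span F (Set.range v)).orthogonalBilin B ↔ ∀ i, B (v i) x = 0 := by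
  constructor
  · exact fun hx i => hx _ (subset_span ⟨i, rfl⟩)
  · intro hx y hy
    have : span F (Set.range v) ≤ LinearMap.ker (B.flip x) := by
      rw [span_le]
      rintro _ ⟨i, rfl⟩
      exact hx i
    exact this hy

theorem span_range_le_orthogonalBilin {ι : Type*} {v : ι → V}
    (hv : ∀ i j, B (v i) (v j) = 0) :
    span F (Set.range v) ≤ (span F (Set.range v)).orthogonalBilin B := by
  rw [span_le]
  rintro _ ⟨j, rfl⟩
  exact mem_orthogonalBilin_span_range.2 fun i => hv i j

/-- The form restricted to `W` has zero radical, so the usual dimension formula for orthogonal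
complements has no correction term. -/
theorem finrank_inf_orthogonalBilin [FiniteDimensional F V] (hB : B.IsAlt) {W D : Submodule F V}
    (hW : hull B W = ⊥) (hD : D ≤ W) :
    finrank F D + finrank F (W ⊓ D.orthogonalBilin B : Submodule F V) = finrank F W := by
  have hR : (B.restrict W).IsRefl := LinearMap.BilinForm.IsAlt.isRefl fun x => hB x
  have key := LinearMap.BilinForm.finrank_add_finrank_orthogonal hR (D.comap W.subtype)
  have h1 : finrank F (D.comap W.subtype) = finrank F D := by
    rw [← finrank_map_subtype_eq, Submodule.map_comap_subtype, inf_eq_right.2 hD]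
  have h2 : (B.restrict W).orthogonal (D.comap W.subtype) =
      (D.orthogonalBilin B).comap W.subtype := by
    ext x
    exact ⟨fun hx y hy => hx ⟨y, hD hy⟩ hy, fun hx y hy => hx y hy⟩
  have h3 : (B.restrict W).orthogonal ⊤ = ⊥ := by
    rw [eq_bot_iff]
    intro x hx
    have : (x : V) ∈ hull B W := ⟨x.2, fun y hy => hx ⟨y, hy⟩ trivial⟩
    rw [hW] at this
    simpa using this
  rw [h1, h2, h3, inf_bot_eq, finrank_bot, ← finrank_map_subtype_eq W (comap _ _),
    Submodule.map_comap_subtype] at key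
  exact key

theorem hull_eq_self_of_finrank_eq [FiniteDimensional F V] {C : Submodule F V}
    (h : finrank F (hull B C) = finrank F C) : hull B C = C :=
  eq_of_le_of_finrank_eq inf_le_left h

end Isotropic

/-! ### Totally isotropic subspaces and the closed formula -/

section Counting

variable {F V : Type*} [Field F] [Fintype F] [AddCommGroup V] [Module F V] [Finite V]
  {B : LinearMap.BilinForm F V}

/-- If `D` is the span of a tuple, the vectors extending it are those of `W` orthogonal to `D` but
outside `D`. Self-orthogonality of the new vector is automatic for an alternating form. -/
theorem ncard_isotropicTuples_succ (hB : B.IsAlt) {W : Submodule F V} (hW : hull B W = ⊥)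
    {d : ℕ} (hd : finrank F W = d) (l : ℕ) : ((isotropicTuples B W (l + 1)).ncard : ℝ) =
      (isotropicTuples B W l).ncard *
        ((Fintype.card F : ℝ) ^ (d - l) - (Fintype.card F : ℝ) ^ l) := by
  rw [← mul_one ((isotropicTuples B W (l + 1)).ncard : ℝ)]
  symm
  refine Set.ncard_mul_eq_ncard_mul (fun (v : Fin l → V) (w : Fin (l + 1) → V) =>
    (Fin.init w : Fin l → V) = v) ?_ ?_
  · rintro v ⟨hv, hvW, hvB⟩
    set D := span F (Set.range v) with hDdef
    have hDl : finrank F D = l := by simpa using finrank_span_eq_card hv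
    have hDW : D ≤ W := span_le.2 (by rintro _ ⟨i, rfl⟩; exact hvW i)
    have hDD : D ≤ W ⊓ D.orthogonalBilin B := le_inf hDW (span_range_le_orthogonalBilin hvB)
    have hfin := finrank_inf_orthogonalBilin hB hW hDW
    have hc : ((((W ⊓ D.orthogonalBilin B : Submodule F V) : Set V) \ (D : Set V)).ncard : ℝ) =
        (Fintype.card F : ℝ) ^ (d - l) - (Fintype.card F : ℝ) ^ l := by
      rw [Set.cast_ncard_sdiff hDD (Set.toFinite _), ncard_submodule, ncard_submodule, hDl,
        show finrank F (W ⊓ D.orthogonalBilin B : Submodule F V) = d - l by omega]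
      push_cast
      rfl
    rw [← hc]
    congr 1
    refine Set.ncard_congr (fun w _ => w (Fin.last l)) ?_ ?_ ?_
    · rintro w ⟨⟨h1, h2, h3⟩, rfl⟩
      refine ⟨⟨h2 _, mem_orthogonalBilin_span_range.2 fun i => h3 _ _⟩, ?_⟩
      rw [← Fin.snoc_init_self w, linearIndependent_finSnoc] at h1
      exact h1.2
    · rintro w w' ⟨-, h1⟩ ⟨-, h2⟩ h
      rw [← Fin.snoc_init_self w, ← Fin.snoc_init_self w', h1, h2, h]
    · rintro x ⟨⟨hxW, hxD⟩, hx⟩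
      have hx' := mem_orthogonalBilin_span_range.1 hxD
      refine ⟨Fin.snoc v x, ⟨⟨linearIndependent_finSnoc.2 ⟨hv, hx⟩, ?_, ?_⟩, by simp⟩, by simp⟩
      · intro i
        refine Fin.lastCases ?_ (fun i => ?_) i <;> simp [SetLike.mem_coe.1 hxW, hvW]
      · intro i j
        refine Fin.lastCases ?_ (fun i => ?_) i <;> refine Fin.lastCases ?_ (fun j => ?_) j
        · simp [hB x]
        · simp only [Fin.snoc_last, Fin.snoc_castSucc]
          rw [← hB.neg_eq, hx', neg_zero]
        · simp [hx']
        · simp [hvB]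
  · rintro w ⟨h1, h2, h3⟩
    have : {v | v ∈ isotropicTuples B W l ∧ Fin.init w = v} = {Fin.init w} := by
      ext v
      constructor
      · rintro ⟨-, rfl⟩; rfl
      · rintro rfl
        rw [← Fin.snoc_init_self w, linearIndependent_finSnoc] at h1
        exact ⟨⟨h1.1, fun i => h2 _, fun i j => h3 _ _⟩, rfl⟩
    rw [this]
    simp

theorem ncard_isotropicTuples (hB : B.IsAlt) {W : Submodule F V} (hW : hull B W = ⊥)
    {d : ℕ} (hd : finrank F W = d) (l : ℕ) : ((isotropicTuples B W l).ncard : ℝ) =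
      ∏ i ∈ Finset.range l, ((Fintype.card F : ℝ) ^ (d - i) - (Fintype.card F : ℝ) ^ i) := by
  induction l with
  | zero =>
    have : isotropicTuples B W 0 = Set.univ :=
      Set.eq_univ_of_forall fun v => ⟨linearIndependent_empty_type, fun i => i.elim0,
        fun i => i.elim0⟩
    simp [this, Set.ncard_univ]
  | succ l ih => rw [ncard_isotropicTuples_succ hB hW hd, ih, Finset.prod_range_succ]

theorem ncard_linearIndependent_mem (C : Submodule F V) {l : ℕ} (hC : finrank F C = l) :
    ({v : Fin l → V | LinearIndependent F v ∧ ∀ i, v i ∈ C}.ncard : ℝ) =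
      ∏ i ∈ Finset.range l, ((Fintype.card F : ℝ) ^ l - (Fintype.card F : ℝ) ^ i) := by
  have himg : {v : Fin l → V | LinearIndependent F v ∧ ∀ i, v i ∈ C} =
      (fun s : Fin l → C => fun i => (s i : V)) '' {s | LinearIndependent F s} := by
    ext v
    constructor
    · rintro ⟨h1, h2⟩
      exact ⟨fun i => ⟨v i, h2 i⟩, LinearIndependent.of_comp C.subtype h1, rfl⟩
    · rintro ⟨s, hs, rfl⟩
      exact ⟨LinearIndependent.map' hs C.subtype (ker_subtype C), fun i => (s i).2⟩
  have hinj : Function.Injective (fun s : Fin l → C => fun i => (s i : V)) := fun s s' h =>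
    funext fun i => Subtype.ext (congrFun h i)
  have hcard := card_linearIndependent (K := F) (V := C) hC.ge
  rw [himg, Set.ncard_image_of_injective _ hinj, ← Nat.card_coe_set_eq]
  change (Nat.card {s : Fin l → C // LinearIndependent F s} : ℝ) = _
  rw [hcard, hC, Fin.prod_univ_eq_prod_range (fun i => Fintype.card F ^ l - Fintype.card F ^ i),
    Nat.cast_prod]
  refine Finset.prod_congr rfl fun i hi => ?_
  rw [Nat.cast_sub (Nat.pow_le_pow_right Fintype.card_pos (Finset.mem_range.1 hi).le)]
  push_cast
  rfl

/-- A subspace as large as its hull is totally isotropic, so all its ordered bases are isotropic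
tuples; conversely each tuple determines its span. -/
theorem ncard_hullSet_self (hB : B.IsAlt) {W : Submodule F V} (hW : hull B W = ⊥)
    {d : ℕ} (hd : finrank F W = d) (l : ℕ) : ((hullSet B W l l).ncard : ℝ) *
      ∏ i ∈ Finset.range l, ((Fintype.card F : ℝ) ^ l - (Fintype.card F : ℝ) ^ i) =
      ∏ i ∈ Finset.range l, ((Fintype.card F : ℝ) ^ (d - i) - (Fintype.card F : ℝ) ^ i) := by
  rw [← ncard_isotropicTuples hB hW hd, ← mul_one ((isotropicTuples B W l).ncard : ℝ)]
  refine Set.ncard_mul_eq_ncard_mul (fun C v => span F (Set.range v) = C) ?_ ?_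
  · rintro C ⟨hCW, hC, hl⟩
    rw [← ncard_linearIndependent_mem C hC]
    have hself := hull_eq_self_of_finrank_eq (hl.trans hC.symm)
    congr 2
    ext v
    constructor
    · rintro ⟨⟨h1, -, -⟩, rfl⟩
      exact ⟨h1, fun i => subset_span ⟨i, rfl⟩⟩
    · rintro ⟨h1, h2⟩
      refine ⟨⟨h1, fun i => hCW (h2 i), fun i j => ?_⟩, ?_⟩
      · have := h2 j
        rw [← hself] at this
        exact this.2 _ (h2 i)
      · refine eq_of_le_of_finrank_eq (span_le.2 ?_) ?_
        · rintro _ ⟨i, rfl⟩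
          exact h2 i
        · rw [finrank_span_eq_card h1, hC, Fintype.card_fin]
  · rintro v ⟨h1, h2, h3⟩
    have : {C | C ∈ hullSet B W l l ∧ span F (Set.range v) = C} = {span F (Set.range v)} := by
      ext C
      constructor
      · rintro ⟨-, rfl⟩; rfl
      · rintro rfl
        have hl : finrank F (span F (Set.range v)) = l := by simpa using finrank_span_eq_card h1
        refine ⟨⟨span_le.2 (by rintro _ ⟨i, rfl⟩; exact h2 i), hl, ?_⟩, rfl⟩
        rw [hull, inf_eq_left.2 (span_range_le_orthogonalBilin h3), hl]
    rw [this]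
    simp

/-- The number of subspaces of dimension `2 k₀ + l` with `l`-dimensional hull in a symplectic
space of dimension `2 (k₀ + s + l)`. -/
theorem ncard_hullSet (hB : B.IsAlt) (k₀ s l : ℕ) {W : Submodule F V} (hW : hull B W = ⊥)
    (hd : finrank F W = 2 * (k₀ + s + l)) :
    ((hullSet B W (2 * k₀ + l) l).ncard : ℝ) =
      (Fintype.card F : ℝ) ^ ((2 * k₀ + l) * (2 * s + l) + l) *
        g ((Fintype.card F : ℝ) ^ 2) (k₀ + s + l) /
        (g ((Fintype.card F : ℝ) ^ 2) k₀ * g ((Fintype.card F : ℝ) ^ 2) s *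
          h (Fintype.card F : ℝ) l) := by
  have hQ : (1 : ℝ) < Fintype.card F := by exact_mod_cast Fintype.one_lt_card
  generalize hq : (Fintype.card F : ℝ) = q at hQ ⊢
  have hQ2 : 1 < q ^ 2 := one_lt_pow₀ hQ two_ne_zero
  have h0 : 0 < q := by positivity
  have hg := g_pos hQ2
  have hh := h_pos hQ l
  induction k₀ generalizing W with
  | zero =>
    have key := ncard_hullSet_self hB hW hd l
    have h1 := prod_isotropic hQ s l
    have h2 := prod_pow_sub_eq_mul_h q l
    have h3 : 0 < ∏ i ∈ Finset.range l, q ^ i := Finset.prod_pos fun i _ => by positivity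
    rw [hq, h2, zero_add] at key
    rw [← key] at h1
    have hs := hg s
    rw [g_zero, one_mul, mul_zero, zero_add, zero_add, eq_div_iff (by positivity)]
    apply mul_left_cancel₀ h3.ne'
    linear_combination h1
  | succ k₀ ih =>
    have key := ncard_hullSet_add_two hB (d := 2 * (k₀ + s + l)) (k := 2 * k₀ + l) (l := l)
      (fun W' hW' hd' => ih hW' hd') hW (by rw [hd]; ring)
    have e1 : k₀ + 1 + s + l = k₀ + s + l + 1 := by ring
    have e2 : 2 * (k₀ + 1) + l = 2 * k₀ + l + 2 := by ring
    have e3 : q ^ (2 * k₀ + l + 2) - q ^ l =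
        q ^ l * (q ^ 2) ^ (k₀ + 1) * (1 - 1 / (q ^ 2) ^ (k₀ + 1)) := by
      rw [← pow_mul, show 2 * k₀ + l + 2 = l + 2 * (k₀ + 1) by ring, pow_add]
      field_simp
    have e4 : q ^ (2 * (k₀ + s + l) + 2) - 1 =
        (q ^ 2) ^ (k₀ + s + l + 1) * (1 - 1 / (q ^ 2) ^ (k₀ + s + l + 1)) := by
      rw [← pow_mul, show 2 * (k₀ + s + l) + 2 = 2 * (k₀ + s + l + 1) by ring]
      field_simp
    have p1 := (g_factor hQ2 (k₀ + 1) (by omega)).1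
    have a1 := hg k₀
    have a2 := hg s
    rw [hq, e3, e4] at key
    rw [e1, e2, g_succ, g_succ, eq_div_iff (by positivity)]
    generalize 1 - 1 / (q ^ 2) ^ (k₀ + 1) = A at *
    generalize 1 - 1 / (q ^ 2) ^ (k₀ + s + l + 1) = A' at *
    -- This exponent collects the powers of `q` multiplying the unknown count in the recursion: `l`,
    -- `2 * (k₀ + 1)` and `2 * k₀ + l + 1`.
    have h4 : 0 < q ^ (4 * k₀ + 3 + 2 * l) := by positivity
    apply mul_left_cancel₀ h4.ne'
    rw [mul_div_assoc', eq_div_iff (by positivity)] at key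
    simp only [← pow_mul] at key ⊢
    have c1 : q ^ (4 * k₀ + 3 + 2 * l) =
        q ^ l * q ^ (2 * (k₀ + 1)) * q ^ (2 * k₀ + l + 1) := by
      rw [← pow_add, ← pow_add]; congr 1; ring
    have c2 : q ^ (4 * k₀ + 3 + 2 * l) * q ^ ((2 * k₀ + l + 2) * (2 * s + l) + l) =
        q ^ (2 * (k₀ + s + l + 1)) * q ^ (2 * (k₀ + s + l) + 1) *
          q ^ ((2 * k₀ + l) * (2 * s + l) + l) := by
      rw [← pow_add, ← pow_add, ← pow_add]; congr 1; ring
    rw [← mul_assoc _ (q ^ ((2 * k₀ + l + 2) * (2 * s + l) + l) : ℝ), c2, c1]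
    linear_combination key

end Counting

end SymplecticHull

/-! ### The standard symplectic space and the limits -/

namespace SymplecticHull

open Module Submodule

theorem sympForm_isAlt (F : Type*) [Field F] (n : ℕ) : (sympForm F n).IsAlt := fun x => by
  change ∑ i : Fin n, (x ⟨i, _⟩ * x ⟨n + i, _⟩ - x ⟨n + i, _⟩ * x ⟨i, _⟩) = 0
  exact Finset.sum_eq_zero fun i _ => by ring

/-- Pairing `y` with the unit vector at the partner index, `n` places away, isolates each coordinate
of `y` up to sign. -/
theorem hull_sympForm_top (F : Type*) [Field F] (n : ℕ) : hull (sympForm F n) ⊤ = ⊥ := by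
  rw [eq_bot_iff]
  rintro y ⟨-, hy⟩
  rw [Submodule.mem_bot]
  ext j
  have hform : ∀ x : Fin (2 * n) → F, ∑ i : Fin n, (x ⟨i, by omega⟩ * y ⟨n + i, by omega⟩ -
      x ⟨n + i, by omega⟩ * y ⟨i, by omega⟩) = 0 := fun x => hy x trivial
  by_cases hj : (j : ℕ) < n
  · have key := hform (Pi.single ⟨n + j, by omega⟩ 1)
    have h1 (i : Fin n) : (⟨i, by omega⟩ : Fin (2 * n)) ≠ ⟨n + j, by omega⟩ :=
      Fin.ne_of_val_ne (by simp only; omega)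
    rw [Finset.sum_eq_single ⟨j, hj⟩] at key
    · have h2 : j ≠ (⟨n + j, by omega⟩ : Fin (2 * n)) := h1 ⟨j, hj⟩
      simpa [Pi.single_apply, h2] using key
    · intro i _ hi
      have h2 : (⟨n + i, by omega⟩ : Fin (2 * n)) ≠ ⟨n + j, by omega⟩ :=
        Fin.ne_of_val_ne (by have := Fin.val_ne_of_ne hi; simp only at this ⊢; omega)
      rw [Pi.single_eq_of_ne (h1 i), Pi.single_eq_of_ne h2]
      simp
    · simp
  · have key := hform (Pi.single ⟨j - n, by omega⟩ 1)
    have h1 (i : Fin n) : (⟨n + i, by omega⟩ : Fin (2 * n)) ≠ ⟨j - n, by omega⟩ :=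
      Fin.ne_of_val_ne (by simp only; omega)
    rw [Finset.sum_eq_single ⟨j - n, by omega⟩] at key
    · have h2 : (⟨n + (j - n), by omega⟩ : Fin (2 * n)) = j := by
        ext
        simp only
        omega
      rw [Pi.single_eq_of_ne (h1 _), Pi.single_eq_same, one_mul, zero_mul, sub_zero] at key
      rwa [← h2]
    · intro i _ hi
      have h2 : (⟨i, by omega⟩ : Fin (2 * n)) ≠ ⟨j - n, by omega⟩ :=
        Fin.ne_of_val_ne (by have := Fin.val_ne_of_ne hi; simpa using this)
      rw [Pi.single_eq_of_ne (h1 i), Pi.single_eq_of_ne h2]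
      simp
    · simp

theorem SHull_eq_hullSet (F : Type*) [Field F] (n k l : ℕ) :
    SHull F n k l = hullSet (sympForm F n) ⊤ k l := by
  ext C
  exact ⟨fun hC => ⟨le_top, hC⟩, fun hC => hC.2⟩

theorem SLCD_eq_SHull (F : Type*) [Field F] (n k : ℕ) : SLCD F n k = SHull F n k 0 := by
  ext C
  exact and_congr_right fun _ => (Submodule.finrank_eq_zero (S := sympHull C)).symm

/-- The proportion of codes with `l`-dimensional symplectic hull. -/
theorem ncard_SHull_div_gaussBinom (F : Type*) [Field F] [Fintype F] (k₀ s l : ℕ) :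
    ((SHull F (k₀ + s + l) (2 * k₀ + l) l).ncard : ℝ) /
        gaussBinom (Fintype.card F : ℝ) (2 * (k₀ + s + l)) (2 * k₀ + l) =
      (Fintype.card F : ℝ) ^ l / h (Fintype.card F : ℝ) l *
        (g ((Fintype.card F : ℝ) ^ 2) (k₀ + s + l) /
          (g ((Fintype.card F : ℝ) ^ 2) k₀ * g ((Fintype.card F : ℝ) ^ 2) s)) *
        (g (Fintype.card F : ℝ) (2 * s + l) * g (Fintype.card F : ℝ) (2 * k₀ + l) /
          g (Fintype.card F : ℝ) (2 * (k₀ + s + l))) := by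
  have hQ : (1 : ℝ) < Fintype.card F := by exact_mod_cast Fintype.one_lt_card
  rw [SHull_eq_hullSet, ncard_hullSet (sympForm_isAlt F _) k₀ s l (hull_sympForm_top F _)
    (by simp), show 2 * (k₀ + s + l) = (2 * s + l) + (2 * k₀ + l) by ring, gaussBinom_add hQ,
    pow_add _ _ l, mul_comm (2 * k₀ + l) (2 * s + l)]
  have hQ2 : (1 : ℝ) < (Fintype.card F : ℝ) ^ 2 := one_lt_pow₀ hQ two_ne_zero
  have h1 := (g_pos hQ2 k₀).ne'
  have h2 := (g_pos hQ2 s).ne'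
  have h3 := (g_pos hQ (2 * s + l)).ne'
  have h4 := (g_pos hQ (2 * k₀ + l)).ne'
  have h5 := (g_pos hQ (2 * s + l + (2 * k₀ + l))).ne'
  have h6 := (h_pos hQ l).ne'
  have h7 : (Fintype.card F : ℝ) ≠ 0 := by positivity
  field_simp

/-- The limit is reparametrised by `k₀` and `s = n - k₀ - l`, both of which become arbitrarily
large. -/
theorem eventually_hullLimit (l N : ℕ) : ∀ᶠ p : ℕ × ℕ in hullLimit l, ∃ k₀ s : ℕ,
    N ≤ k₀ ∧ N ≤ s ∧ p = (k₀ + s + l, 2 * k₀ + l) := by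
  have h1 : ∀ᶠ p : ℕ × ℕ in hullLimit l, 2 * N + l ≤ p.2 :=
    (tendsto_comap.mono_left (inf_le_left.trans inf_le_left)).eventually_ge_atTop _
  have h2 : ∀ᶠ p : ℕ × ℕ in hullLimit l, 2 * (N : ℤ) + l ≤ 2 * (p.1 : ℤ) - p.2 :=
    (tendsto_comap.mono_left (inf_le_left.trans inf_le_right)).eventually_ge_atTop _
  have h3 : ∀ᶠ p : ℕ × ℕ in hullLimit l, l ≤ p.2 ∧ p.2 ≤ 2 * p.1 ∧ ∃ k₀ : ℕ, p.2 = 2 * k₀ + l :=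
    le_principal_iff.1 inf_le_right
  filter_upwards [h1, h2, h3] with p h1 h2 ⟨_, _, k₀, hk⟩
  refine ⟨k₀, p.1 - k₀ - l, by omega, by omega, Prod.ext ?_ hk⟩
  simp only
  omega

theorem tendsto_ncard_SHull_div (F : Type*) [Field F] [Fintype F] (l : ℕ) :
    Tendsto (fun p : ℕ × ℕ =>
        ((SHull F p.1 p.2 l).ncard : ℝ) / gaussBinom (Fintype.card F : ℝ) (2 * p.1) p.2)
      (hullLimit l) (𝓝 ((Fintype.card F : ℝ) ^ l * gInf (Fintype.card F : ℝ) /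
        (h (Fintype.card F : ℝ) l * gInf ((Fintype.card F : ℝ) ^ 2)))) := by
  have hQ : (1 : ℝ) < Fintype.card F := by exact_mod_cast Fintype.one_lt_card
  have hQ2 : (1 : ℝ) < (Fintype.card F : ℝ) ^ 2 := one_lt_pow₀ hQ two_ne_zero
  have tend : ∀ φ : ℕ × ℕ → ℕ, (∀ k₀ s N, N ≤ k₀ → N ≤ s → N ≤ φ (k₀ + s + l, 2 * k₀ + l)) →
      Tendsto φ (hullLimit l) atTop := fun φ hφ => tendsto_atTop.2 fun N => by
    filter_upwards [eventually_hullLimit l N] with p ⟨k₀, s, h1, h2, hp⟩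
    exact hp ▸ hφ k₀ s N h1 h2
  have t1 := (tendsto_g hQ2).comp (tend (fun p => p.1) fun _ _ _ _ _ => by simp only; omega)
  -- This index and the next recover `k₀` and `s` from `(n, k)`.
  have t2 := (tendsto_g hQ2).comp (tend (fun p => (p.2 - l) / 2) fun _ _ _ _ _ => by
    simp only; omega)
  have t3 := (tendsto_g hQ2).comp (tend (fun p => p.1 - (p.2 + l) / 2) fun _ _ _ _ _ => by
    simp only; omega)
  have t4 := (tendsto_g hQ).comp (tend (fun p => 2 * p.1 - p.2) fun _ _ _ _ _ => by
    simp only; omega)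
  have t5 := (tendsto_g hQ).comp (tend (fun p => p.2) fun _ _ _ _ _ => by simp only; omega)
  have t6 := (tendsto_g hQ).comp (tend (fun p => 2 * p.1) fun _ _ _ _ _ => by simp only; omega)
  have g1 := (gInf_pos hQ).ne'
  have g2 := (gInf_pos hQ2).ne'
  have h1 := (h_pos hQ l).ne'
  -- The `g` factors at `q ^ 2` leave one reciprocal of their limit, and those at `q` leave one copy
  -- of theirs.
  have key := ((tendsto_const_nhds (x := (Fintype.card F : ℝ) ^ l / h (Fintype.card F : ℝ) l)).mul
    (t1.div (t2.mul t3) (mul_ne_zero g2 g2))).mul ((t4.mul t5).div t6 g1)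
  refine Tendsto.congr' ?_ (key.trans (le_of_eq (congrArg 𝓝 (by field_simp))))
  filter_upwards [eventually_hullLimit l 0] with p ⟨k₀, s, _, _, hp⟩
  subst hp
  rw [ncard_SHull_div_gaussBinom]
  have e2 : (2 * k₀ + l - l) / 2 = k₀ := by omega
  have e3 : k₀ + s + l - (2 * k₀ + l + l) / 2 = s := by omega
  have e4 : 2 * (k₀ + s + l) - (2 * k₀ + l) = 2 * s + l := by omega
  simp only [Pi.div_apply, Function.comp_apply, e2, e3, e4]

/-- The bound `k₀ ≤ n` is not part of `lcdLimit`, but it holds eventually because the integer `n -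
k₀` tends to infinity. -/
theorem tendsto_lcdLimit_hullLimit :
    Tendsto (fun p : ℕ × ℕ => (p.1, 2 * p.2)) lcdLimit (hullLimit 0) := by
  have h1 : Tendsto (fun p : ℕ × ℕ => p.2) lcdLimit atTop := tendsto_comap.mono_left inf_le_left
  have h2 : Tendsto (fun p : ℕ × ℕ => (p.1 : ℤ) - p.2) lcdLimit atTop :=
    tendsto_comap.mono_left inf_le_right
  refine tendsto_inf.2 ⟨tendsto_inf.2 ⟨tendsto_comap_iff.2 ?_, tendsto_comap_iff.2 ?_⟩,
    tendsto_principal.2 ?_⟩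
  · refine tendsto_atTop.2 fun N => ?_
    filter_upwards [h1.eventually_ge_atTop N] with p hp
    simp only [Function.comp_apply]
    omega
  · refine tendsto_atTop.2 fun N => ?_
    filter_upwards [h2.eventually_ge_atTop N, h2.eventually_ge_atTop 0] with p hp hp'
    simp only [Function.comp_apply]
    push_cast
    omega
  · filter_upwards [h2.eventually_ge_atTop 0] with p hp
    exact ⟨Nat.zero_le _, show 2 * p.2 ≤ 2 * p.1 by omega, p.2, rfl⟩

end SymplecticHull

theorem mainTheorem7 (F : Type*) [Field F] [Fintype F] (q : ℕ) (hq : Fintype.card F = q) :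
    (∀ l : ℕ, Tendsto
      (fun p : ℕ × ℕ =>
        ((SymplecticHull.SHull F p.1 p.2 l).ncard : ℝ) /
          SymplecticHull.gaussBinom (q : ℝ) (2 * p.1) p.2)
      (SymplecticHull.hullLimit l)
      (𝓝 ((q : ℝ) ^ l * SymplecticHull.gInf (q : ℝ) /
        (SymplecticHull.h (q : ℝ) l * SymplecticHull.gInf ((q : ℝ) ^ 2))))) ∧
    Tendsto
      (fun p : ℕ × ℕ =>
        ((SymplecticHull.SHull F p.1 p.2 0).ncard : ℝ) /
          SymplecticHull.gaussBinom (q : ℝ) (2 * p.1) p.2)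
      (SymplecticHull.hullLimit 0)
      (𝓝 (SymplecticHull.gInf (q : ℝ) / SymplecticHull.gInf ((q : ℝ) ^ 2))) ∧
    Tendsto
      (fun p : ℕ × ℕ =>
        ((SymplecticHull.SLCD F p.1 (2 * p.2)).ncard : ℝ) /
          SymplecticHull.gaussBinom (q : ℝ) (2 * p.1) (2 * p.2))
      SymplecticHull.lcdLimit
      (𝓝 (SymplecticHull.gInf (q : ℝ) / SymplecticHull.gInf ((q : ℝ) ^ 2))) := by
  subst hq
  have h0 := SymplecticHull.tendsto_ncard_SHull_div F 0
  rw [pow_zero, one_mul, SymplecticHull.h_zero, one_mul] at h0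
  refine ⟨SymplecticHull.tendsto_ncard_SHull_div F, h0, ?_⟩
  refine (h0.comp SymplecticHull.tendsto_lcdLimit_hullLimit).congr fun p => ?_
  dsimp only [Function.comp_apply]
  rw [SymplecticHull.SLCD_eq_SHull]
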